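/- Let $\zeta$ be the Riemann zeta function (analytically continued), and write $1/\zeta$ for its reciprocal, with the value $1/\zeta(1)=0$ at the pole of $\zeta$. For $n\in\mathbb{N}_0$ and $\alpha\in\mathbb{C}$ let $$P_n(\alpha)=(-1)^n\binom{\alpha}{n}=\frac{(-1)^n}{n!}\prod_{m=0}^{n-1}(\alpha-m).$$ Then for every $s\in\mathbb{C}$ with $\operatorname{Re}(s)>1$, $$\frac{1}{\zeta(s)}=\sum_{n=0}^{\infty}\left[\sum_{k=0}^{n}P_k(n)\,\frac{1}{\zeta(k)}\right]P_n(s),$$ where the series over $n$ converges absolutely. -/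

import Mathlib

noncomputable section

/-- The `n`-th Pochhammer–Newton polynomial
`P_n(α) = (-1)^n binom(α, n) = ((-1)^n / n!) ∏_{m=0}^{n-1} (α - m)`. -/
def pochhammerNewton (n : ℕ) (α : ℂ) : ℂ :=
  (-1) ^ n / (n.factorial : ℂ) * ∏ m ∈ Finset.range n, (α - (m : ℂ))

/-- The reciprocal Riemann zeta function `1/ζ`. Since `ζ` has a pole at `1`, the value of `1/ζ`
there is `0` (Mathlib's `riemannZeta 1` is an arbitrary finite number, hence the case split). -/
def recipZeta (s : ℂ) : ℂ :=
  if s = 1 then 0 else 1 / riemannZeta s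

end

open Filter Topology Finset

/-! Write `1/ζ(s) = ∑ μ(m) m^(-s)` and expand each `x^s`, `x = 1/m`, in the binomial series `∑
(1-x)^n P_n(s)`. Since `∑ P_n(s) = ∑ n P_n(s) = 0` for `Re s > 1`, `(1-x)^n` may be replaced by
`powRemainder n x`, which is at most `(n x)^c` for `1 ≤ c ≤ 2`. With `1 < c < min (Re s) 2` the
double series converges absolutely, so it may be summed over `m` first. That inner sum is the
bracket without its `k = 0, 1` terms, i.e. the bracket plus 2; the 2 drops out because `∑ P_n(s) =
0`. -/

lemma pochhammerNewton_zero (s : ℂ) : pochhammerNewton 0 s = 1 := by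
  simp [pochhammerNewton]

lemma pochhammerNewton_one (s : ℂ) : pochhammerNewton 1 s = -s := by
  simp [pochhammerNewton]

lemma pochhammerNewton_eq_choose (n : ℕ) (s : ℂ) :
    pochhammerNewton n s = (-1) ^ n * Ring.choose s n := by
  rw [Ring.choose_eq_smul, Polynomial.descPochhammer_smeval_eq_ascPochhammer,
    Polynomial.ascPochhammer_smeval_cast, Polynomial.ascPochhammer_smeval_eq_eval,
    ← descPochhammer_eval_eq_ascPochhammer, descPochhammer_eval_eq_prod_range,
    pochhammerNewton, smul_eq_mul]
  ring

lemma pochhammerNewton_natCast (k n : ℕ) :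
    pochhammerNewton k (n : ℂ) = (-1) ^ k * (n.choose k : ℂ) := by
  rw [pochhammerNewton_eq_choose, Ring.choose_natCast]

lemma pochhammerNewton_succ (n : ℕ) (s : ℂ) :
    (n + 1 : ℂ) * pochhammerNewton (n + 1) s = -s * pochhammerNewton n (s - 1) := by
  have h : ((n : ℂ) + 1) ≠ 0 := by exact_mod_cast n.succ_ne_zero
  have hf : (n.factorial : ℂ) ≠ 0 := by exact_mod_cast n.factorial_ne_zero
  have hp : ∏ m ∈ range n, (s - ((m + 1 : ℕ) : ℂ)) = ∏ m ∈ range n, (s - 1 - (m : ℂ)) :=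
    prod_congr rfl fun m _ => by push_cast; ring
  rw [pochhammerNewton, pochhammerNewton, prod_range_succ', hp, Nat.factorial_succ]
  push_cast
  field_simp
  ring

lemma sum_range_pochhammerNewton (n : ℕ) (s : ℂ) :
    ∑ k ∈ range (n + 1), pochhammerNewton k s = pochhammerNewton n (s - 1) := by
  induction n with
  | zero => simp [pochhammerNewton_zero]
  | succ n ih =>
    have h := Ring.choose_succ_succ (s - 1) n
    rw [sub_add_cancel] at h
    rw [sum_range_succ, ih]
    simp only [pochhammerNewton_eq_choose, h]
    ring

lemma pochhammerNewton_succ_mul_GammaSeq (s : ℂ) (hs : ∀ k : ℕ, s ≠ k) (n : ℕ) :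
    pochhammerNewton (n + 1) s * (n + 1) * Complex.GammaSeq (-s) n = (n : ℂ) ^ (-s) := by
  have h : ((n : ℂ) + 1) ≠ 0 := by exact_mod_cast n.succ_ne_zero
  have hf : (n.factorial : ℂ) ≠ 0 := by exact_mod_cast n.factorial_ne_zero
  have hp : ∏ j ∈ range (n + 1), (-s + (j : ℂ)) =
      (-1) ^ (n + 1) * ∏ j ∈ range (n + 1), (s - (j : ℂ)) := by
    rw [← card_range (n + 1), ← prod_const, card_range, ← prod_mul_distrib]
    exact prod_congr rfl fun m _ => by ring
  have hne : ∏ j ∈ range (n + 1), (s - (j : ℂ)) ≠ 0 :=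
    prod_ne_zero_iff.mpr fun j _ => sub_ne_zero.mpr (hs j)
  rw [Complex.GammaSeq, hp, pochhammerNewton, Nat.factorial_succ]
  push_cast
  field_simp

/-- Euler's limit for `Γ(-s)` gives `P_{n+1}(s) = O(n^(-Re s - 1))`; when `s` is a natural number,
where `Γ(-s)` has a pole, the sequence is finitely supported. -/
lemma summable_rpow_mul_norm_pochhammerNewton {s : ℂ} {c : ℝ} (hc : c < s.re) :
    Summable fun n : ℕ => (n : ℝ) ^ c * ‖pochhammerNewton n s‖ := by
  by_cases hs : ∃ k : ℕ, s = k
  · obtain ⟨k, rfl⟩ := hs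
    refine summable_of_ne_finset_zero (s := range (k + 1)) fun n hn => ?_
    rw [pochhammerNewton_natCast, Nat.choose_eq_zero_of_lt (by simpa using hn)]
    simp
  push Not at hs
  have hG : Complex.Gamma (-s) ≠ 0 := Complex.Gamma_ne_zero fun m h => hs m (neg_injective h)
  have hlim := (Complex.GammaSeq_tendsto_Gamma (-s)).norm
  have hpos : 0 < ‖Complex.Gamma (-s)‖ / 2 := by positivity
  have hev := hlim.eventually_const_lt (half_lt_self (norm_pos_iff.mpr hG))
  rw [← summable_nat_add_iff 1]
  have hsum : Summable fun n : ℕ =>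
      (2 : ℝ) ^ |c| * (‖Complex.Gamma (-s)‖ / 2)⁻¹ * (n : ℝ) ^ (c - s.re - 1) :=
    (Real.summable_nat_rpow.mpr (by linarith)).mul_left _
  refine Summable.of_norm_bounded_eventually_nat hsum ?_
  filter_upwards [hev, eventually_ge_atTop 1] with n hn hn1
  have hn0 : (0 : ℝ) < n := by exact_mod_cast hn1
  have key := congrArg norm (pochhammerNewton_succ_mul_GammaSeq s hs n)
  rw [norm_mul, norm_mul, Complex.norm_natCast_cpow_of_pos hn1, Complex.neg_re] at key
  have hnn : ‖((n : ℂ) + 1)‖ = n + 1 := by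
    exact_mod_cast Complex.norm_natCast (n + 1)
  rw [hnn] at key
  have h1 : ‖pochhammerNewton (n + 1) s‖ * n * (‖Complex.Gamma (-s)‖ / 2) ≤ (n : ℝ) ^ (-s.re) := by
    rw [← key]; gcongr; linarith
  have h2 : ‖pochhammerNewton (n + 1) s‖ ≤
      (‖Complex.Gamma (-s)‖ / 2)⁻¹ * (n : ℝ) ^ (-s.re - 1) := by
    rw [Real.rpow_sub_one hn0.ne', ← div_eq_inv_mul, div_div, le_div_iff₀ (by positivity),
      ← mul_assoc]
    exact h1
  have h3 : ((n + 1 : ℕ) : ℝ) ^ c ≤ (2 : ℝ) ^ |c| * (n : ℝ) ^ c := by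
    have h1n : (1 : ℝ) ≤ n := by exact_mod_cast hn1
    have hr : ((n + 1 : ℕ) : ℝ) = (1 + 1 / n) * n := by push_cast; field_simp
    rw [hr, Real.mul_rpow (by positivity) hn0.le]
    gcongr
    have ha : (1 : ℝ) ≤ 1 + 1 / n := by simp
    have hb : 1 + 1 / (n : ℝ) ≤ 2 := by
      have : 1 / (n : ℝ) ≤ 1 := by rw [div_le_one hn0]; exact h1n
      linarith
    exact (Real.rpow_le_rpow_of_exponent_le ha (le_abs_self c)).trans
      (Real.rpow_le_rpow (by positivity) hb (abs_nonneg c))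
  rw [Real.norm_of_nonneg (by positivity)]
  calc _ ≤ ((2 : ℝ) ^ |c| * (n : ℝ) ^ c) *
        ((‖Complex.Gamma (-s)‖ / 2)⁻¹ * (n : ℝ) ^ (-s.re - 1)) := by gcongr
    _ = _ := by
      rw [show c - s.re - 1 = c + (-s.re - 1) by ring, Real.rpow_add hn0]; ring

lemma summable_pochhammerNewton {s : ℂ} (hs : 0 < s.re) :
    Summable fun n : ℕ => pochhammerNewton n s := by
  refine Summable.of_norm ?_
  simpa using summable_rpow_mul_norm_pochhammerNewton (c := 0) hs

/-- The partial sums are `P_n(s-1)`. A nonzero limit would let `∑ |P_n(s-1)|/n`, which converges,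
dominate the harmonic series. -/
lemma hasSum_pochhammerNewton {s : ℂ} (hs : 0 < s.re) :
    HasSum (fun n : ℕ => pochhammerNewton n s) 0 := by
  have hsum := summable_pochhammerNewton hs
  have hlim := (tendsto_add_atTop_iff_nat 1).mpr hsum.hasSum.tendsto_sum_nat
  simp only [sum_range_pochhammerNewton] at hlim
  suffices h0 : ∑' n, pochhammerNewton n s = 0 from h0 ▸ hsum.hasSum
  by_contra hL
  have hpos := norm_pos_iff.mpr hL
  have hev := hlim.norm.eventually_const_lt (half_lt_self hpos)
  have hinv := (summable_rpow_mul_norm_pochhammerNewton (s := s - 1) (c := -1)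
    (by simpa using hs)).mul_left (‖∑' n, pochhammerNewton n s‖ / 2)⁻¹
  refine Real.not_summable_natCast_inv (Summable.of_norm_bounded_eventually_nat hinv ?_)
  filter_upwards [hev] with n hn
  rw [norm_inv, Real.norm_natCast, Real.rpow_neg_one, ← div_eq_inv_mul, le_div_iff₀ (half_pos hpos)]
  gcongr

lemma hasSum_natCast_mul_pochhammerNewton {s : ℂ} (hs : 1 < s.re) :
    HasSum (fun n : ℕ => (n : ℂ) * pochhammerNewton n s) 0 := by
  rw [← hasSum_nat_add_iff' 1]
  have h := (hasSum_pochhammerNewton (s := s - 1) (by simpa using hs)).mul_left (-s)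
  simp only [← pochhammerNewton_succ] at h
  simpa using h

lemma hasSum_pow_mul_pochhammerNewton (s : ℂ) {x : ℝ} (hx0 : 0 < x) (hx1 : x ≤ 1) :
    HasSum (fun n : ℕ => (((1 - x) ^ n : ℝ) : ℂ) * pochhammerNewton n s) ((x : ℂ) ^ s) := by
  have h := (Complex.one_add_cpow_hasFPowerSeriesOnBall_zero (a := s)).hasSum
    (y := ((x - 1 : ℝ) : ℂ)) (by
      rw [← ENNReal.ofReal_one, Metric.eball_ofReal, mem_ball_zero_iff, Complex.norm_real,
        Real.norm_eq_abs, abs_lt]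
      constructor <;> linarith)
  convert! h using 1
  · ext n
    rw [pochhammerNewton_eq_choose, binomialSeries_apply, List.ofFn_const, List.prod_replicate,
      smul_eq_mul]
    push_cast
    rw [show (x : ℂ) - 1 = -1 * (1 - x) by ring, mul_pow]
    ring
  · push_cast; ring_nf

/-- The remainder of `(1 - x) ^ n` after its first-order Taylor expansion at `0`. -/
def powRemainder (n : ℕ) (x : ℝ) : ℝ := (1 - x) ^ n - 1 + n * x

lemma one_sub_mul_le_one_sub_pow (n : ℕ) {x : ℝ} (h1 : x ≤ 1) :
    1 - n * x ≤ (1 - x) ^ n := by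
  have := one_add_mul_le_pow (a := -x) (by linarith) n
  simpa [sub_eq_add_neg] using this

lemma powRemainder_nonneg (n : ℕ) {x : ℝ} (h1 : x ≤ 1) : 0 ≤ powRemainder n x := by
  have := one_sub_mul_le_one_sub_pow n h1
  rw [powRemainder]; linarith

lemma powRemainder_le_sq (n : ℕ) {x : ℝ} (h0 : 0 ≤ x) (h1 : x ≤ 1) :
    powRemainder n x ≤ (n * x) ^ 2 := by
  induction n with
  | zero => simp [powRemainder]
  | succ n ih =>
    have h := mul_le_mul_of_nonneg_left (one_sub_mul_le_one_sub_pow n h1) h0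
    have hn : 0 ≤ (n : ℝ) * x ^ 2 := by positivity
    rw [powRemainder] at *
    push_cast
    rw [pow_succ]
    nlinarith [sq_nonneg x]

/-- With `y = n x`, the remainder is at most both `y` and `y^2`, hence at most any intermediate
power. -/
lemma powRemainder_le_rpow (n : ℕ) {x c : ℝ} (h0 : 0 ≤ x) (h1 : x ≤ 1) (hc1 : 1 ≤ c)
    (hc2 : c ≤ 2) : powRemainder n x ≤ (n : ℝ) ^ c * x ^ c := by
  have hy : 0 ≤ (n : ℝ) * x := by positivity
  rw [← Real.mul_rpow (by positivity) h0]
  rcases le_total ((n : ℝ) * x) 1 with h | h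
  · calc _ ≤ ((n : ℝ) * x) ^ (2 : ℝ) := by exact_mod_cast powRemainder_le_sq n h0 h1
      _ ≤ _ := Real.rpow_le_rpow_of_exponent_ge' hy h (by linarith) hc2
  · have hp : (1 - x) ^ n ≤ 1 := pow_le_one₀ (by linarith) (by linarith)
    calc _ ≤ (n : ℝ) * x := by rw [powRemainder]; linarith
      _ ≤ _ := Real.self_le_rpow_of_one_le h hc1

lemma sum_pochhammerNewton_mul_pow (n : ℕ) (x : ℝ) :
    ∑ k ∈ range (n + 1), pochhammerNewton k (n : ℂ) * (if 2 ≤ k then (x : ℂ) ^ k else 0) =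
      powRemainder n x := by
  have h : ∀ k : ℕ, (if 2 ≤ k then (x : ℂ) ^ k else 0) =
      x ^ k - (if k = 0 then 1 else 0) - (if k = 1 then (x : ℂ) else 0) := by
    rintro (_ | _ | k) <;> simp
  have hb : ∑ k ∈ range (n + 1), pochhammerNewton k (n : ℂ) * (x : ℂ) ^ k = (1 - x) ^ n := by
    rw [sub_eq_add_neg, add_comm (1 : ℂ), add_pow]
    refine sum_congr rfl fun k _ => ?_
    rw [pochhammerNewton_natCast, neg_pow (x : ℂ)]
    ring
  simp only [h, mul_sub, sum_sub_distrib, hb, mul_ite, mul_one, mul_zero, sum_ite_eq', mem_range,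
    Nat.zero_lt_succ, if_true, pochhammerNewton_zero, pochhammerNewton_one]
  rw [powRemainder]
  rcases n with _ | n
  · simp
  · rw [if_pos (by lia)]
    push_cast
    ring

open ArithmeticFunction in
lemma hasSum_moebius_mul_cpow {s : ℂ} (hs : 1 < s.re) :
    HasSum (fun m : ℕ => (moebius m : ℂ) * ((m : ℝ)⁻¹ : ℝ) ^ s) (1 / riemannZeta s) := by
  have h := (LSeriesSummable_moebius_iff.mpr hs).LSeriesHasSum
  rw [show LSeries (fun n => (moebius n : ℂ)) s = 1 / riemannZeta s from
    eq_one_div_of_mul_eq_one_right (by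
      rw [← LSeries_one_eq_riemannZeta hs]; exact LSeries_one_mul_Lseries_moebius hs)] at h
  rw [LSeriesHasSum] at h
  convert! h using 1
  ext m
  rcases eq_or_ne m 0 with rfl | hm
  · simp
  · rw [LSeries.term_of_ne_zero hm, Complex.ofReal_inv, Complex.ofReal_natCast,
      Complex.inv_cpow _ _ (by rw [Complex.natCast_arg]; exact Real.pi_pos.ne), div_eq_mul_inv]

open ArithmeticFunction in
lemma hasSum_moebius_mul_ite_pow (k : ℕ) :
    HasSum (fun m : ℕ => (moebius m : ℂ) * (if 2 ≤ k then (((m : ℝ)⁻¹ : ℝ) : ℂ) ^ k else 0))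
      (recipZeta k + if k = 0 then 2 else 0) := by
  rcases k with _ | _ | k
  -- `1/ζ(0) = -2` cancels the correction term 2.
  · norm_num [recipZeta, riemannZeta_zero, hasSum_zero]
  · simp [recipZeta, hasSum_zero]
  · have h := hasSum_moebius_mul_cpow (s := ((k + 2 : ℕ) : ℂ))
      (by rw [Complex.natCast_re]; push_cast; linarith [Nat.cast_nonneg (α := ℝ) k])
    have hne : ((k + 2 : ℕ) : ℂ) ≠ 1 := by exact_mod_cast (by lia : k + 2 ≠ 1)
    simpa only [Complex.cpow_natCast, recipZeta, if_neg hne, Nat.le_add_left, if_true,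
      Nat.add_eq_zero_iff, OfNat.ofNat_ne_zero, and_false, if_false, add_zero, add_assoc,
      Nat.reduceAdd] using h

open ArithmeticFunction in
lemma hasSum_moebius_mul_powRemainder (n : ℕ) :
    HasSum (fun m : ℕ => (moebius m : ℂ) * powRemainder n ((m : ℝ)⁻¹))
      ((∑ k ∈ range (n + 1), pochhammerNewton k (n : ℂ) * recipZeta (k : ℂ)) + 2) := by
  have h := hasSum_sum (s := range (n + 1)) fun k _ =>
    (hasSum_moebius_mul_ite_pow k).mul_left (pochhammerNewton k (n : ℂ))
  convert! h using 1
  · ext m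
    rw [← sum_pochhammerNewton_mul_pow, mul_sum]
    exact sum_congr rfl fun k _ => by ring
  · simp [mul_add, sum_add_distrib, pochhammerNewton_zero]

lemma hasSum_powRemainder_mul_pochhammerNewton {s : ℂ} (hs : 1 < s.re) {x : ℝ} (hx0 : 0 < x)
    (hx1 : x ≤ 1) :
    HasSum (fun n : ℕ => (powRemainder n x : ℂ) * pochhammerNewton n s) ((x : ℂ) ^ s) := by
  have h := ((hasSum_pow_mul_pochhammerNewton s hx0 hx1).sub
    (hasSum_pochhammerNewton (by linarith))).add
    ((hasSum_natCast_mul_pochhammerNewton hs).mul_left (x : ℂ))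
  convert! h using 1
  · ext n
    rw [powRemainder]
    push_cast
    ring
  · simp

open ArithmeticFunction in
lemma summable_moebius_mul_powRemainder_mul_pochhammerNewton {s : ℂ} (hs : 1 < s.re) :
    Summable fun p : ℕ × ℕ =>
      (moebius p.2 : ℂ) * powRemainder p.1 ((p.2 : ℝ)⁻¹) * pochhammerNewton p.1 s := by
  -- `c > 1` makes the sum over `m` converge, `c < Re s` the sum over `n`, and `c < 2` permits the
  -- remainder bound.
  obtain ⟨c, hc1, hc⟩ := exists_between (lt_min hs one_lt_two)
  have hm : Summable fun m : ℕ => ((m : ℝ)⁻¹) ^ c := by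
    simpa [Real.inv_rpow] using Real.summable_nat_rpow_inv.mpr hc1
  have hprod := (summable_rpow_mul_norm_pochhammerNewton (hc.trans_le (min_le_left _ _))).mul_of_nonneg
    hm (fun n => by positivity) (fun m => by positivity)
  refine hprod.of_norm_bounded fun p => ?_
  have hx1 : ((p.2 : ℝ)⁻¹) ≤ 1 := Nat.cast_inv_le_one p.2
  have hμ : ‖((moebius p.2 : ℤ) : ℂ)‖ ≤ 1 := by
    rw [Complex.norm_intCast]
    exact_mod_cast abs_moebius_le_one
  have hr := powRemainder_le_rpow p.1 (by positivity) hx1 hc1.le (hc.le.trans (min_le_right _ _))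
  have hr0 := powRemainder_nonneg p.1 hx1
  rw [norm_mul, norm_mul, Complex.norm_real, Real.norm_of_nonneg hr0]
  calc _ ≤ 1 * ((p.1 : ℝ) ^ c * ((p.2 : ℝ)⁻¹) ^ c) * ‖pochhammerNewton p.1 s‖ := by gcongr
    _ = _ := by ring

theorem corollaryC (s : ℂ) (hs : 1 < s.re) :
    HasSum
      (fun n : ℕ =>
        (∑ k ∈ Finset.range (n + 1), pochhammerNewton k (n : ℂ) * recipZeta (k : ℂ)) *
          pochhammerNewton n s)
      (1 / riemannZeta s) := by
  have hsum := summable_moebius_mul_powRemainder_mul_pochhammerNewton hs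
  have hrow := hsum.hasSum.prod_fiberwise fun n =>
    (hasSum_moebius_mul_powRemainder n).mul_right (pochhammerNewton n s)
  have hcol := ((Equiv.prodComm ℕ ℕ).hasSum_iff.mpr hsum.hasSum).prod_fiberwise
    (g := fun m => (ArithmeticFunction.moebius m : ℂ) * ((m : ℝ)⁻¹ : ℝ) ^ s) fun m => by
      rcases eq_or_ne m 0 with rfl | hm
      · simp [hasSum_zero]
      · have h := (hasSum_powRemainder_mul_pochhammerNewton hs (x := (m : ℝ)⁻¹)
          (by positivity) (Nat.cast_inv_le_one m)).mul_left (ArithmeticFunction.moebius m : ℂ)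
        simpa [mul_assoc] using h
  rw [hcol.unique (hasSum_moebius_mul_cpow hs)] at hrow
  -- Removes the 2 contributed by the missing `k = 0` term.
  have h := hrow.sub ((hasSum_pochhammerNewton (by linarith)).mul_left 2)
  convert! h using 1
  · ext n
    ring
  · simp
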